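/- Let $(S,\mathcal S,Q)$ be a probability space and let $h:S\times\mathbb R\to\mathbb R$ be such that $h(\cdot,t)$ is measurable for every $t\in\mathbb R$ and $h(x,\cdot)$ is convex for every $x\in S$. Denote by $D^+h(x,t)$ and $D^-h(x,t)$ the right and left derivatives of $h(x,\cdot)$ at $t$, and assume $\int_S|D^{+}h(x,t)|\,Q(dx)<\infty$ and $\int_S|D^{-}h(x,t)|\,Q(dx)<\infty$ for all $t\in\mathbb R$. Fix $t_0\in\mathbb R$ and put $$M(t)=\int_S \big(h(x,t)-h(x,t_0)\big)\,Q(dx),\qquad t\in\mathbb R.$$ Let $X_1,X_2,\dots$ be i.i.d. $S$-valued random variables with distribution $Q$ on a probability space $(\Omega,\mathcal A,\mathbb P)$, let $$M_n(t)=\frac1n\sum_{i=1}^n \big(h(X_i,t)-h(X_i,t_0)\big),$$ and for $n\ge1$ let $\hat m_n$ be the smallest minimizing point of $M_n$; on outcomes where $M_n$ has no smallest minimizing point, $\hat m_n$ is an arbitrary real number. Suppose that $m\in\mathbb R$ is the unique minimizer of $M$ and that for some $s>1$ there is an $x_0>0$ with $$\mathbb E\big[|D^+h(X_1,m+x)|^s\big]<\infty\qquad\text{for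 all }x\in[-x_0,x_0].$$ Then, for every $x>0$, $$\mathbb P\Big(\sup_{k\ge n}|\hat m_k-m|>x\Big)=o(n^{1-s})\qquad\text{as }n\to\infty .$$ (If the arbitrary values of $\hat m_k$ make the event non-measurable, $\mathbb P$ is read as outer probability.) -/

import Mathlib

open MeasureTheory ProbabilityTheory Filter Topology Asymptotics

/-- The right derivative `D⁺f(t)` of a real function. -/
noncomputable def rightDerivative (f : ℝ → ℝ) (t : ℝ) : ℝ :=
  derivWithin f (Set.Ioi t) t

/-- The left derivative `D⁻f(t)` of a real function. -/
noncomputable def leftDerivative (f : ℝ → ℝ) (t : ℝ) : ℝ :=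
  derivWithin f (Set.Iio t) t

/-- The set `A(f)` of all minimizing points of `f : ℝ → ℝ`. -/
def minimumSet (f : ℝ → ℝ) : Set ℝ :=
  {t | ∀ u, f t ≤ f u}

/-- The criterion function `M(t) = ∫ h(x,t) - h(x,t₀) Q(dx)`. -/
noncomputable def criterion {S : Type*} [MeasurableSpace S]
    (h : S → ℝ → ℝ) (Q : Measure S) (t₀ t : ℝ) : ℝ :=
  ∫ x, (h x t - h x t₀) ∂Q

/-- The empirical criterion function
`Mₙ(t) = (1/n) ∑ h(Xᵢ,t) - h(Xᵢ,t₀)`, summed over the first `n` observations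
`X 0, …, X (n - 1)` at the outcome `ω`. -/
noncomputable def empiricalCriterion {S Ω : Type*}
    (h : S → ℝ → ℝ) (X : ℕ → Ω → S) (t₀ : ℝ) (n : ℕ) (ω : Ω) (t : ℝ) : ℝ :=
  (1 / (n : ℝ)) * ∑ i ∈ Finset.range n, (h (X i ω) t - h (X i ω) t₀)

/-- `mhat` is the smallest minimizing point estimator: for each sample size `n ≥ 1` and each outcome
`ω` at which the empirical criterion function has a smallest minimizing point, `mhat n ω` is that
point. Nothing is required of `mhat n ω` where there is no such point. -/
def IsSmallestMEstimator {S Ω : Type*} (h : S → ℝ → ℝ) (X : ℕ → Ω → S) (t₀ : ℝ)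
    (mhat : ℕ → Ω → ℝ) : Prop :=
  ∀ n : ℕ, 1 ≤ n → ∀ (ω : Ω) (t : ℝ),
    IsLeast (minimumSet (empiricalCriterion h X t₀ n ω)) t → mhat n ω = t

/-! Convexity localizes the minimizer through two signs. Put `y = min x x₀`. If the sum of the right
derivatives over the first `k` observations is negative at `m - y` and positive at `m + y`, then the
empirical criterion has a least minimizing point, and it lies in `[m - y, m + y]`
(`exists_isLeast_minimumSet_empiricalCriterion`). Integrating the subgradient inequality and using
uniqueness of `m` shows that the corresponding means are strictly negative and strictly positive. So
the event forces, for some `k ≥ n`, a nonnegative partial sum of i.i.d. variables of negative mean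
with finite `s`-th moment.

The rate for such sums (`isLittleO_measureReal_exists_sum_nonneg`) comes from truncation. Some `Yᵢ`
exceeds `δ * max i n` with probability `o(n ^ (1 - s))`, by Markov's inequality with a vanishing
tail integral. Otherwise every `k`-th sum with `k ≥ n` is unaffected by truncating its terms at `δ *
k`, and a Chernoff bound with parameter of order `log k / k` gives `O(k ^ (-(s + 1)))`, which sums
to `O(n ^ (-s))`. -/

/-! ### Convex functions and their minimizers -/

theorem ConvexOn.add_rightDerivative_mul_le {f : ℝ → ℝ} (hf : ConvexOn ℝ Set.univ f) (t u : ℝ) :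
    f t + rightDerivative f t * (u - t) ≤ f u := by
  have hi : ∀ y : ℝ, y ∈ interior (Set.univ : Set ℝ) := by simp
  rcases lt_trichotomy t u with h | h | h
  · have h1 := hf.rightDeriv_le_slope_of_mem_interior (hi t) (Set.mem_univ u) h
    rw [slope_def_field, le_div_iff₀ (sub_pos.2 h)] at h1
    unfold rightDerivative
    linarith
  · simp [h]
  · have h1 := (hf.slope_le_leftDeriv_of_mem_interior (Set.mem_univ u) (hi t) h).trans
      (hf.leftDeriv_le_rightDeriv_of_mem_interior (hi t))
    rw [slope_def_field, div_le_iff₀ (sub_pos.2 h)] at h1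
    unfold rightDerivative
    linarith

theorem ConvexOn.hasDerivWithinAt_rightDerivative {f : ℝ → ℝ} (hf : ConvexOn ℝ Set.univ f)
    (t : ℝ) : HasDerivWithinAt f (rightDerivative f t) (Set.Ioi t) t :=
  hf.hasDerivWithinAt_rightDeriv_of_mem_interior (by simp)

theorem measurable_rightDerivative {S : Type*} [MeasurableSpace S] {h : S → ℝ → ℝ}
    (h_meas : ∀ t, Measurable (fun x => h x t))
    (h_conv : ∀ x, ConvexOn ℝ Set.univ (h x)) (t : ℝ) :
    Measurable (fun x => rightDerivative (h x) t) := by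
  let u : ℕ → ℝ := fun n => t + 1 / ((n : ℝ) + 1)
  have hu : Tendsto u atTop (𝓝[Set.Ioi t \ {t}] t) := by
    refine tendsto_nhdsWithin_iff.2 ⟨?_, Eventually.of_forall fun n => ?_⟩
    · simpa [u] using (tendsto_one_div_add_atTop_nhds_zero_nat (𝕜 := ℝ)).const_add t
    · have : 0 < 1 / ((n : ℝ) + 1) := by positivity
      refine ⟨?_, ?_⟩
      · simpa [u] using this
      · simp only [u, Set.mem_singleton_iff]
        linarith
  refine measurable_of_tendsto_metrizable (f := fun n x => slope (h x) t (u n)) (fun n => ?_) ?_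
  · simp only [slope_def_field]
    exact ((h_meas _).sub (h_meas _)).div_const _
  · refine tendsto_pi_nhds.2 fun x => ?_
    exact (hasDerivWithinAt_iff_tendsto_slope.1 ((h_conv x).hasDerivWithinAt_rightDerivative t)).comp hu

/-- A convex function with a negative right derivative at `a` and points beyond `b` that are
worse than `b` has a least minimizing point, which lies in `[a, b]`. -/
theorem ConvexOn.exists_isLeast_minimumSet {F : ℝ → ℝ} (hF : ConvexOn ℝ Set.univ F) {a b d : ℝ}
    (hab : a < b) (hd : HasDerivWithinAt F d (Set.Ioi a) a) (hd0 : d < 0)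
    (hb : ∀ u, b < u → F b < F u) :
    ∃ t ∈ Set.Icc a b, IsLeast (minimumSet F) t := by
  have hcont : Continuous F := by
    rw [← continuousOn_univ]
    exact hF.continuousOn isOpen_univ
  -- A point left of `a` no worse than `a'` would, by convexity, force `F a ≤ F a'`.
  obtain ⟨a', ha', hFa'⟩ : ∃ a' ∈ Set.Ioo a b, F a' < F a := by
    have h1 := hasDerivWithinAt_iff_tendsto_slope.1 hd
    rw [Set.sdiff_singleton_eq_self (by simp)] at h1
    have h2 := (h1.eventually (gt_mem_nhds hd0)).and (Ioo_mem_nhdsGT hab)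
    obtain ⟨y, hy, hy'⟩ := h2.exists
    refine ⟨y, hy', ?_⟩
    rw [slope_def_field, div_lt_iff₀ (sub_pos.2 hy'.1)] at hy
    linarith
  have ha : ∀ u, u < a → F a' < F u := by
    intro u hu
    by_contra! hcon
    have := hF.le_max_of_mem_Icc (Set.mem_univ u) (Set.mem_univ a') (z := a) ⟨hu.le, ha'.1.le⟩
    rw [max_eq_right hcon] at this
    linarith
  obtain ⟨t, ht, htmin⟩ := isCompact_Icc.exists_isMinOn (Set.nonempty_Icc.2 hab.le)
    (hcont.continuousOn (s := Set.Icc a b))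
  have htmin' : ∀ u ∈ Set.Icc a b, F t ≤ F u := fun u hu => htmin hu
  have hne : (minimumSet F).Nonempty := by
    refine ⟨t, fun u => ?_⟩
    by_cases h1 : u < a
    · exact (htmin' a' ⟨ha'.1.le, ha'.2.le⟩).trans (ha u h1).le
    by_cases h2 : b < u
    · exact (htmin' b ⟨hab.le, le_rfl⟩).trans (hb u h2).le
    exact htmin' u ⟨not_lt.1 h1, not_lt.1 h2⟩
  have hsub : minimumSet F ⊆ Set.Icc a b := by
    intro v hv
    refine ⟨?_, ?_⟩ <;> by_contra! hcon
    · exact (ha v hcon).not_ge (hv a')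
    · exact (hb v hcon).not_ge (hv b)
  have hcl : IsClosed (minimumSet F) := by
    have : minimumSet F = ⋂ u, {t | F t ≤ F u} := by
      ext v
      simp [minimumSet]
    rw [this]
    exact isClosed_iInter fun u => isClosed_le hcont continuous_const
  obtain ⟨v, hv⟩ := (isCompact_Icc.of_isClosed_subset hcl hsub).exists_isLeast hne
  exact ⟨v, hsub hv.1, hv⟩

theorem exists_isLeast_minimumSet_empiricalCriterion {S Ω : Type*} {h : S → ℝ → ℝ}
    (h_conv : ∀ x, ConvexOn ℝ Set.univ (h x)) (X : ℕ → Ω → S) (t₀ : ℝ) {n : ℕ} (hn : 1 ≤ n)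
    (ω : Ω) {a b : ℝ} (hab : a < b)
    (ha : ∑ i ∈ Finset.range n, rightDerivative (h (X i ω)) a < 0)
    (hb : 0 < ∑ i ∈ Finset.range n, rightDerivative (h (X i ω)) b) :
    ∃ t ∈ Set.Icc a b, IsLeast (minimumSet (empiricalCriterion h X t₀ n ω)) t := by
  have hn0 : (0 : ℝ) < 1 / (n : ℝ) := by positivity
  have hF : ConvexOn ℝ Set.univ (empiricalCriterion h X t₀ n ω) := by
    refine ⟨convex_univ, fun u _ v _ p q hp hq hpq => ?_⟩
    simp only [empiricalCriterion, smul_eq_mul]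
    have : ∑ i ∈ Finset.range n, (h (X i ω) (p * u + q * v) - h (X i ω) t₀) ≤
        p * ∑ i ∈ Finset.range n, (h (X i ω) u - h (X i ω) t₀) +
          q * ∑ i ∈ Finset.range n, (h (X i ω) v - h (X i ω) t₀) := by
      rw [Finset.mul_sum, Finset.mul_sum, ← Finset.sum_add_distrib]
      refine Finset.sum_le_sum fun i _ => ?_
      have h1 := (h_conv (X i ω)).2 (Set.mem_univ u) (Set.mem_univ v) hp hq hpq
      simp only [smul_eq_mul] at h1
      have h2 : h (X i ω) t₀ = p * h (X i ω) t₀ + q * h (X i ω) t₀ := by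
        rw [← add_mul, hpq, one_mul]
      linarith
    have := mul_le_mul_of_nonneg_left this hn0.le
    linarith
  refine hF.exists_isLeast_minimumSet
    (d := 1 / (n : ℝ) * ∑ i ∈ Finset.range n, rightDerivative (h (X i ω)) a) hab ?_
    (mul_neg_of_pos_of_neg hn0 ha) fun u hu => ?_
  · exact (HasDerivWithinAt.fun_sum fun i _ =>
      ((h_conv (X i ω)).hasDerivWithinAt_rightDerivative a).sub_const _).const_mul _
  · simp only [empiricalCriterion]
    refine mul_lt_mul_of_pos_left ?_ hn0
    have h1 : ∑ i ∈ Finset.range n, (h (X i ω) b - h (X i ω) t₀) +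
        (∑ i ∈ Finset.range n, rightDerivative (h (X i ω)) b) * (u - b) ≤
        ∑ i ∈ Finset.range n, (h (X i ω) u - h (X i ω) t₀) := by
      rw [Finset.sum_mul, ← Finset.sum_add_distrib]
      refine Finset.sum_le_sum fun i _ => ?_
      linarith [(h_conv (X i ω)).add_rightDerivative_mul_le b u]
    have := mul_pos hb (sub_pos.2 hu)
    linarith

/-! ### Signs of the mean right derivatives -/

section
variable {S : Type*} [MeasurableSpace S] {Q : Measure S} {h : S → ℝ → ℝ}

/-- The supporting lines at `u` and at `t` squeeze the difference between integrable functions. -/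
theorem integrable_sub_of_integrable_rightDerivative
    (h_meas : ∀ t, Measurable (fun x => h x t))
    (h_conv : ∀ x, ConvexOn ℝ Set.univ (h x))
    (h_right : ∀ t, Integrable (fun x => rightDerivative (h x) t) Q) (t u : ℝ) :
    Integrable (fun x => h x t - h x u) Q := by
  refine integrable_of_le_of_le ((h_meas t).sub (h_meas u)).aestronglyMeasurable
    (Eventually.of_forall fun x => ?_) (Eventually.of_forall fun x => ?_)
    ((h_right u).mul_const (t - u)) ((h_right t).mul_const (t - u))
  · linarith [(h_conv x).add_rightDerivative_mul_le u t]
  · linarith [(h_conv x).add_rightDerivative_mul_le t u]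

theorem integral_rightDerivative_mul_le
    (h_meas : ∀ t, Measurable (fun x => h x t))
    (h_conv : ∀ x, ConvexOn ℝ Set.univ (h x))
    (h_right : ∀ t, Integrable (fun x => rightDerivative (h x) t) Q) (t₀ t u : ℝ) :
    (∫ x, rightDerivative (h x) t ∂Q) * (u - t) ≤ criterion h Q t₀ u - criterion h Q t₀ t := by
  have hi := integrable_sub_of_integrable_rightDerivative h_meas h_conv h_right
  unfold criterion
  rw [← integral_mul_const, ← integral_sub (hi _ _) (hi _ _)]
  refine integral_mono ((h_right t).mul_const _) ((hi _ _).sub (hi _ _)) fun x => ?_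
  simp only
  linarith [(h_conv x).add_rightDerivative_mul_le t u]

theorem criterion_lt_of_minimumSet_eq_singleton {t₀ m : ℝ}
    (h_unique : minimumSet (criterion h Q t₀) = {m}) {t : ℝ} (ht : t ≠ m) :
    criterion h Q t₀ m < criterion h Q t₀ t := by
  have hm : m ∈ minimumSet (criterion h Q t₀) := by simp [h_unique]
  by_contra! hcon
  have : t ∈ minimumSet (criterion h Q t₀) := fun u => hcon.trans (hm u)
  rw [h_unique] at this
  exact ht this

end

/-! ### Elementary inequalities -/

/-- Replaces the second-order Taylor bound when only a `q`-th moment is available: `u ^ 2 ≤ |u| ^ q`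
for `|u| ≤ 1`, while `|u| ^ q` dominates `|u|` and `1` beyond. -/
theorem Real.exp_le_one_add_add_rpow_mul_exp {q u K : ℝ} (hq : 1 < q) (hq2 : q ≤ 2) (hK : 0 ≤ K)
    (hu : u ≤ K) : Real.exp u ≤ 1 + u + |u| ^ q * Real.exp K := by
  have hK1 : 1 ≤ Real.exp K := Real.one_le_exp hK
  have hp : 0 ≤ |u| ^ q := by positivity
  have hp' : |u| ^ q ≤ |u| ^ q * Real.exp K := le_mul_of_one_le_right hp hK1
  rcases le_or_gt |u| 1 with h1 | h1
  · have h2 := (abs_le.1 (Real.abs_exp_sub_one_sub_id_le h1)).2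
    have h3 : u ^ 2 ≤ |u| ^ q := by
      rw [← sq_abs, ← Real.rpow_natCast]
      exact Real.rpow_le_rpow_of_exponent_ge' (abs_nonneg u) h1 (by linarith) (by simpa using hq2)
    linarith
  · have h2 : |u| ≤ |u| ^ q := by
      simpa using Real.rpow_le_rpow_of_exponent_le h1.le hq.le
    rcases le_or_gt 0 u with h3 | h3
    · have : Real.exp K ≤ |u| ^ q * Real.exp K :=
        le_mul_of_one_le_left (Real.exp_pos K).le (h1.le.trans h2)
      have := Real.exp_le_exp.2 hu
      linarith
    · have : Real.exp u ≤ 1 := Real.exp_le_one_iff.2 h3.le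
      rw [abs_of_neg h3] at *
      linarith

/-- Telescoping against `k ^ (1 - s)`; the factor `2 ^ s` pays for passing from `k + 1` back to `k`.
-/
theorem sum_range_add_rpow_neg_le {s : ℝ} (hs : 1 < s) {n : ℕ} (hn : 1 ≤ n) (N : ℕ) :
    ∑ j ∈ Finset.range N, ((n + j : ℕ) : ℝ) ^ (-s) ≤
      2 ^ s / (s - 1) * (n : ℝ) ^ (1 - s) := by
  have hs0 : 0 < s - 1 := by linarith
  have key : ∀ k : ℕ, 1 ≤ k →
      (k : ℝ) ^ (-s) ≤ 2 ^ s / (s - 1) * ((k : ℝ) ^ (1 - s) - ((k + 1 : ℕ) : ℝ) ^ (1 - s)) := by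
    intro k hk
    have hk0 : (0 : ℝ) < k := by exact_mod_cast hk
    have hk1 : (1 : ℝ) ≤ k := by exact_mod_cast hk
    push_cast
    set K : ℝ := (k : ℝ) + 1 with hK
    have hK0 : 0 < K := by positivity
    have h1 : 1 + (s - 1) / K ≤ ((k : ℝ) / K) ^ (1 - s) := by
      have h2 : (k : ℝ) / K ≤ Real.exp (-(1 / K)) := by
        have : (k : ℝ) / K = 1 - 1 / K := by field_simp; linarith
        rw [this]
        exact Real.one_sub_le_exp_neg _
      have h3 := Real.rpow_le_rpow_of_nonpos (by positivity) h2 (by linarith : 1 - s ≤ 0)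
      rw [← Real.exp_mul] at h3
      have h4 := Real.add_one_le_exp (-(1 / K) * (1 - s))
      have h5 : -(1 / K) * (1 - s) + 1 = 1 + (s - 1) / K := by ring
      linarith
    rw [Real.div_rpow hk0.le hK0.le, le_div_iff₀ (by positivity)] at h1
    have h6 : K ^ (-s) = K ^ (1 - s) / K := by
      rw [show -s = 1 - s - 1 by ring, Real.rpow_sub_one hK0.ne']
    have h7 : (s - 1) * K ^ (-s) ≤ (k : ℝ) ^ (1 - s) - K ^ (1 - s) := by
      rw [h6]
      have : (1 + (s - 1) / K) * K ^ (1 - s) = K ^ (1 - s) + (s - 1) * (K ^ (1 - s) / K) := by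
        ring
      linarith
    have h8 : (2 : ℝ) ^ (-s) * (k : ℝ) ^ (-s) ≤ K ^ (-s) := by
      rw [← Real.mul_rpow (by norm_num) hk0.le]
      exact Real.rpow_le_rpow_of_nonpos hK0 (by linarith) (by linarith)
    have h9 : (2 : ℝ) ^ s * 2 ^ (-s) = 1 := by
      rw [← Real.rpow_add (by norm_num)]; simp
    calc (k : ℝ) ^ (-s) = 2 ^ s / (s - 1) * ((s - 1) * (2 ^ (-s) * (k : ℝ) ^ (-s))) := by
          have : (2 : ℝ) ^ s / (s - 1) * ((s - 1) * (2 ^ (-s) * (k : ℝ) ^ (-s)))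
            = ((2 : ℝ) ^ s * 2 ^ (-s)) * (k : ℝ) ^ (-s) := by field_simp
          rw [this, h9, one_mul]
      _ ≤ _ := by
          refine mul_le_mul_of_nonneg_left (le_trans ?_ h7) (by positivity)
          exact mul_le_mul_of_nonneg_left h8 hs0.le
  calc ∑ j ∈ Finset.range N, ((n + j : ℕ) : ℝ) ^ (-s)
      ≤ ∑ j ∈ Finset.range N, 2 ^ s / (s - 1) *
          (((n + j : ℕ) : ℝ) ^ (1 - s) - ((n + (j + 1) : ℕ) : ℝ) ^ (1 - s)) :=
        Finset.sum_le_sum fun j _ => key (n + j) (by omega)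
    _ = 2 ^ s / (s - 1) * ((n : ℝ) ^ (1 - s) - ((n + N : ℕ) : ℝ) ^ (1 - s)) := by
        rw [← Finset.mul_sum, Finset.sum_range_sub' (fun j => ((n + j : ℕ) : ℝ) ^ (1 - s))]
        simp
    _ ≤ _ := by
        have : 0 ≤ ((n + N : ℕ) : ℝ) ^ (1 - s) := by positivity
        refine mul_le_mul_of_nonneg_left (by linarith) (by positivity)

/-! ### Chernoff bound for truncated sums -/

section
variable {Ω : Type*} [MeasurableSpace Ω] {P : Measure Ω} [IsProbabilityMeasure P]

theorem measureReal_iUnion_le_of_sum_range_le {A : ℕ → Set Ω} {c : ℝ}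
    (hc : ∀ N, ∑ j ∈ Finset.range N, P.real (A j) ≤ c) : P.real (⋃ j, A j) ≤ c := by
  have hc0 : 0 ≤ c := by simpa using hc 0
  refine ENNReal.toReal_le_of_le_ofReal hc0 ((measure_iUnion_le A).trans ?_)
  refine ENNReal.tsum_le_of_sum_range_le fun N => ?_
  rw [ENNReal.le_ofReal_iff_toReal_le (by simp) hc0, ENNReal.toReal_sum (by simp)]
  exact hc N

/-- Truncating only from above lowers `Y`, so the linear term stays nonpositive in mean, and it
increases no absolute value because `0 ≤ c`. -/
theorem mgf_min_const_le {Y : Ω → ℝ} (hY : Measurable Y) {q : ℝ} (hq : 1 < q) (hq2 : q ≤ 2)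
    (hint : Integrable Y P) (hintq : Integrable (fun ω => |Y ω| ^ q) P) (hmean : ∫ ω, Y ω ∂P ≤ 0)
    {c l : ℝ} (hc : 0 ≤ c) (hl : 0 ≤ l) :
    Integrable (fun ω => Real.exp (l * min (Y ω) c)) P ∧
    mgf (fun ω => min (Y ω) c) P l ≤
      Real.exp (l ^ q * Real.exp (l * c) * ∫ ω, |Y ω| ^ q ∂P) := by
  have hm : Measurable fun ω => min (Y ω) c := hY.min measurable_const
  have hexp : Integrable (fun ω => Real.exp (l * min (Y ω) c)) P := by
    refine Integrable.of_bound (hm.const_mul l).exp.aestronglyMeasurable (Real.exp (l * c))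
      (Eventually.of_forall fun ω => ?_)
    rw [Real.norm_eq_abs, Real.abs_exp]
    exact Real.exp_le_exp.2 (mul_le_mul_of_nonneg_left (min_le_right _ _) hl)
  refine ⟨hexp, ?_⟩
  have hpt : ∀ ω, Real.exp (l * min (Y ω) c) ≤
      1 + l * Y ω + (l ^ q * Real.exp (l * c)) * |Y ω| ^ q := by
    intro ω
    have h1 := Real.exp_le_one_add_add_rpow_mul_exp hq hq2 (mul_nonneg hl hc)
      (mul_le_mul_of_nonneg_left (min_le_right (Y ω) c) hl)
    have h2 : |min (Y ω) c| ≤ |Y ω| := by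
      rcases le_total (Y ω) c with h | h
      · rw [min_eq_left h]
      · rw [min_eq_right h, abs_of_nonneg hc]
        exact h.trans (le_abs_self _)
    have h3 : |l * min (Y ω) c| ^ q ≤ l ^ q * |Y ω| ^ q := by
      rw [abs_mul, abs_of_nonneg hl, Real.mul_rpow hl (abs_nonneg _)]
      exact mul_le_mul_of_nonneg_left
        (Real.rpow_le_rpow (abs_nonneg _) h2 (by linarith)) (by positivity)
    have h4 := mul_le_mul_of_nonneg_right h3 (Real.exp_pos (l * c)).le
    have h5 := mul_le_mul_of_nonneg_left (min_le_left (Y ω) c) hl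
    linarith
  have hi1 : Integrable (fun ω => 1 + l * Y ω) P := (integrable_const 1).add (hint.const_mul l)
  calc mgf (fun ω => min (Y ω) c) P l
      ≤ ∫ ω, (1 + l * Y ω + (l ^ q * Real.exp (l * c)) * |Y ω| ^ q) ∂P :=
        integral_mono hexp (hi1.add (hintq.const_mul _)) hpt
    _ = 1 + l * (∫ ω, Y ω ∂P) + (l ^ q * Real.exp (l * c)) * ∫ ω, |Y ω| ^ q ∂P := by
        rw [integral_add hi1 (hintq.const_mul _),
          integral_add (integrable_const 1) (hint.const_mul l), integral_const_mul,
          integral_const_mul]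
        simp
    _ ≤ 1 + (l ^ q * Real.exp (l * c)) * ∫ ω, |Y ω| ^ q ∂P := by
        linarith [mul_nonpos_of_nonneg_of_nonpos hl hmean]
    _ ≤ _ := by
        rw [add_comm]
        exact Real.add_one_le_exp _

/-- A Chernoff bound for sums of independent variables truncated from above. -/
theorem measureReal_sum_min_ge_le {Y : ℕ → Ω → ℝ} (hY : ∀ i, Measurable (Y i))
    (hindep : iIndepFun Y P) (hid : ∀ i, IdentDistrib (Y i) (Y 0) P P) {q : ℝ} (hq : 1 < q)
    (hq2 : q ≤ 2) (hint : Integrable (Y 0) P) (hintq : Integrable (fun ω => |Y 0 ω| ^ q) P)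
    (hmean : ∫ ω, Y 0 ω ∂P ≤ 0) {c l : ℝ} (hc : 0 ≤ c) (hl : 0 ≤ l) (k : ℕ) (r : ℝ) :
    P.real {ω | r ≤ ∑ i ∈ Finset.range k, min (Y i ω) c} ≤
      Real.exp (-l * r + k * (l ^ q * Real.exp (l * c) * ∫ ω, |Y 0 ω| ^ q ∂P)) := by
  have hg : Measurable fun y : ℝ => min y c := measurable_id.min measurable_const
  have hZm : ∀ i, Measurable fun ω => min (Y i ω) c := fun i => hg.comp (hY i)
  have hZi : iIndepFun (fun i ω => min (Y i ω) c) P :=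
    hindep.comp (fun _ y => min y c) fun _ => hg
  obtain ⟨hexp, hmgf⟩ := mgf_min_const_le (hY 0) hq hq2 hint hintq hmean hc hl
  have hZid : ∀ i, IdentDistrib (fun ω => min (Y i ω) c) (fun ω => min (Y 0 ω) c) P P :=
    fun i => (hid i).comp hg
  have hexpi : ∀ i, Integrable (fun ω => Real.exp (l * min (Y i ω) c)) P := fun i =>
    ((hZid i).comp (u := fun z => Real.exp (l * z)) (by fun_prop)).integrable_iff.2 hexp
  have h1 := measure_ge_le_exp_mul_mgf (X := ∑ i ∈ Finset.range k, fun ω => min (Y i ω) c) r hl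
    (hZi.integrable_exp_mul_sum hZm fun i _ => hexpi i)
  rw [hZi.mgf_sum hZm] at h1
  simp only [Finset.sum_apply] at h1
  refine h1.trans ?_
  rw [Real.exp_add, Real.exp_nat_mul]
  refine mul_le_mul_of_nonneg_left ?_ (Real.exp_pos _).le
  calc ∏ i ∈ Finset.range k, mgf (fun ω => min (Y i ω) c) P l
      = ∏ _i ∈ Finset.range k, mgf (fun ω => min (Y 0 ω) c) P l :=
        Finset.prod_congr rfl fun i _ => by rw [mgf_congr_identDistrib (hZid i)]
    _ = mgf (fun ω => min (Y 0 ω) c) P l ^ k := by simp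
    _ ≤ _ := pow_le_pow_left₀ mgf_nonneg hmgf k

end

/-! ### Convergence rates by truncation -/

/-- This vanishing factor turns the Markov bound `O` into `o`. -/
theorem tendsto_setIntegral_lt_abs_rpow {Ω : Type*} [MeasurableSpace Ω] {P : Measure Ω}
    {Y : Ω → ℝ} (hY : Measurable Y) {s : ℝ}
    (hint : Integrable (fun ω => |Y ω| ^ s) P) {δ : ℝ} (hδ : 0 < δ) :
    Tendsto (fun n : ℕ => ∫ ω in {ω | δ * n < |Y ω|}, |Y ω| ^ s ∂P) atTop (𝓝 0) := by
  have hms : ∀ n : ℕ, MeasurableSet {ω | δ * n < |Y ω|} := fun n =>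
    measurableSet_lt measurable_const hY.abs
  simp_rw [← integral_indicator (hms _)]
  rw [← integral_zero Ω ℝ (μ := P)]
  refine tendsto_integral_of_dominated_convergence (fun ω => |Y ω| ^ s)
    (fun n => (hint.indicator (hms n)).aestronglyMeasurable) hint
    (fun n => Eventually.of_forall fun ω => ?_) (Eventually.of_forall fun ω => ?_)
  · refine (norm_indicator_le_norm_self _ _).trans ?_
    rw [Real.norm_eq_abs, abs_of_nonneg (by positivity)]
  · refine tendsto_const_nhds.congr' ?_
    have := (tendsto_natCast_atTop_atTop (R := ℝ)).const_mul_atTop hδ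
    filter_upwards [this.eventually_ge_atTop |Y ω|] with n hn
    rw [Set.indicator_of_notMem]
    simpa using hn

section
variable {Ω : Type*} [MeasurableSpace Ω] {P : Measure Ω} [IsProbabilityMeasure P]

/-- Markov's inequality on the tail. Allowing `r ≤ d` lets a single tail integral, at level `δ * n`,
serve all thresholds `δ * k` with `k ≥ n`. -/
theorem measureReal_lt_le_rpow_neg_mul_setIntegral {Y : Ω → ℝ} (hY : Measurable Y) {s : ℝ}
    (hs : 0 ≤ s) (hint : Integrable (fun ω => |Y ω| ^ s) P) {r d : ℝ} (hd : 0 < d) (hrd : r ≤ d) :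
    P.real {ω | d < Y ω} ≤ d ^ (-s) * ∫ ω in {ω | r < |Y ω|}, |Y ω| ^ s ∂P := by
  have hms : MeasurableSet {ω | d < Y ω} := measurableSet_lt measurable_const hY
  have hsub : {ω | d < Y ω} ⊆ {ω | r < |Y ω|} := fun ω hω =>
    (hrd.trans_lt hω).trans_le (le_abs_self _)
  have h1 : d ^ s * P.real {ω | d < Y ω} ≤ ∫ ω in {ω | d < Y ω}, |Y ω| ^ s ∂P :=
    setIntegral_ge_of_const_le_real hms (measure_ne_top _ _)
      (fun ω hω => Real.rpow_le_rpow hd.le ((le_of_lt hω).trans (le_abs_self _)) hs)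
      hint.integrableOn
  have h2 : ∫ ω in {ω | d < Y ω}, |Y ω| ^ s ∂P ≤ ∫ ω in {ω | r < |Y ω|}, |Y ω| ^ s ∂P :=
    setIntegral_mono_set hint.integrableOn
      (Eventually.of_forall fun ω => by positivity) hsub.eventuallyLE
  rw [Real.rpow_neg hd.le, ← div_eq_inv_mul, le_div_iff₀ (by positivity)]
  linarith

/-- The `n` indices below `n` cost `n * n ^ (-s)`, the later ones the series of `k ^ (-s)`. The
threshold with `max i n` makes one event govern all `k ≥ n`. -/
theorem isLittleO_measureReal_exists_mul_max_lt {Y : ℕ → Ω → ℝ} (hY : ∀ i, Measurable (Y i))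
    (hid : ∀ i, IdentDistrib (Y i) (Y 0) P P) {s : ℝ} (hs : 1 < s)
    (hint : Integrable (fun ω => |Y 0 ω| ^ s) P) {δ : ℝ} (hδ : 0 < δ) :
    (fun n : ℕ => P.real {ω | ∃ i, δ * (max i n : ℕ) < Y i ω})
      =o[atTop] (fun n : ℕ => (n : ℝ) ^ (1 - s)) := by
  set T : ℕ → ℝ := fun n => ∫ ω in {ω | δ * n < |Y 0 ω|}, |Y 0 ω| ^ s ∂P with hT
  have hT0 : Tendsto T atTop (𝓝 0) := tendsto_setIntegral_lt_abs_rpow (hY 0) hint hδ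
  have hTnn : ∀ n, 0 ≤ T n := fun n => integral_nonneg fun ω => by positivity
  set C : ℝ := 2 ^ s / (s - 1) with hC
  have hP : ∀ i n k : ℕ, 1 ≤ n → n ≤ k →
      P.real {ω | δ * k < Y i ω} ≤ δ ^ (-s) * T n * (k : ℝ) ^ (-s) := by
    intro i n k hn hk
    have hk0 : (0 : ℝ) < k := by exact_mod_cast (by omega : 0 < k)
    have h1 : P.real {ω | δ * k < Y i ω} = P.real {ω | δ * k < Y 0 ω} := by
      have := (hid i).measure_mem_eq (measurableSet_Ioi (a := δ * (k : ℝ)))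
      simp only [measureReal_def]
      exact congrArg ENNReal.toReal this
    rw [h1]
    refine (measureReal_lt_le_rpow_neg_mul_setIntegral (hY 0) (by linarith) hint
      (r := δ * n) (by positivity) (by gcongr)).trans (le_of_eq ?_)
    rw [Real.mul_rpow hδ.le hk0.le]
    ring
  have hbound : ∀ n : ℕ, 1 ≤ n → P.real {ω | ∃ i, δ * (max i n : ℕ) < Y i ω} ≤
      (δ ^ (-s) * (1 + C) * T n) * (n : ℝ) ^ (1 - s) := by
    intro n hn
    have hn0 : (0 : ℝ) < n := by exact_mod_cast (by omega : 0 < n)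
    have hsub : {ω | ∃ i, δ * (max i n : ℕ) < Y i ω} ⊆
        (⋃ i ∈ Finset.range n, {ω | δ * n < Y i ω}) ∪
          ⋃ j : ℕ, {ω | δ * (n + j : ℕ) < Y (n + j) ω} := by
      rintro ω ⟨i, hi⟩
      rcases lt_or_ge i n with h | h
      · left
        rw [max_eq_right h.le] at hi
        simp only [Set.mem_iUnion, Finset.mem_range]
        exact ⟨i, h, hi⟩
      · right
        rw [max_eq_left h] at hi
        refine Set.mem_iUnion.2 ⟨i - n, ?_⟩
        simpa only [Set.mem_ofPred_eq, Nat.add_sub_cancel' h] using hi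
    have h1 : P.real (⋃ i ∈ Finset.range n, {ω | δ * n < Y i ω}) ≤
        δ ^ (-s) * T n * (n : ℝ) ^ (1 - s) := by
      refine (measureReal_biUnion_finset_le _ _).trans
        ((Finset.sum_le_sum fun i _ => hP i n n hn le_rfl).trans (le_of_eq ?_))
      rw [Finset.sum_const, Finset.card_range, nsmul_eq_mul, sub_eq_add_neg,
        Real.rpow_add hn0, Real.rpow_one]
      ring
    have h2 : P.real (⋃ j : ℕ, {ω | δ * (n + j : ℕ) < Y (n + j) ω}) ≤
        δ ^ (-s) * T n * (C * (n : ℝ) ^ (1 - s)) := by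
      refine measureReal_iUnion_le_of_sum_range_le fun N => ?_
      refine (Finset.sum_le_sum fun j _ => hP (n + j) n (n + j) hn (by omega)).trans ?_
      rw [← Finset.mul_sum]
      exact mul_le_mul_of_nonneg_left (sum_range_add_rpow_neg_le hs hn N)
        (mul_nonneg (by positivity) (hTnn n))
    calc _ ≤ _ := measureReal_mono hsub
      _ ≤ _ := measureReal_union_le _ _
      _ ≤ _ := add_le_add h1 h2
      _ = _ := by ring
  have hlim : Tendsto (fun n => δ ^ (-s) * (1 + C) * T n) atTop (𝓝 0) := by
    simpa using hT0.const_mul (δ ^ (-s) * (1 + C))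
  refine IsBigO.trans_isLittleO (g := fun n : ℕ => (δ ^ (-s) * (1 + C) * T n) * (n : ℝ) ^ (1 - s))
    ?_ ?_
  · refine IsBigO.of_bound 1 ?_
    filter_upwards [eventually_ge_atTop 1] with n hn
    rw [one_mul, Real.norm_of_nonneg measureReal_nonneg]
    exact (hbound n hn).trans (le_abs_self _)
  · simpa using ((isLittleO_one_iff ℝ).2 hlim).mul_isBigO (isBigO_refl _ atTop)

theorem eventually_measureReal_sum_min_ge_le {Y : ℕ → Ω → ℝ} (hY : ∀ i, Measurable (Y i))
    (hindep : iIndepFun Y P) (hid : ∀ i, IdentDistrib (Y i) (Y 0) P P) {q : ℝ} (hq : 1 < q)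
    (hq2 : q ≤ 2) (hint : Integrable (Y 0) P) (hintq : Integrable (fun ω => |Y 0 ω| ^ q) P)
    (hmean : ∫ ω, Y 0 ω ∂P ≤ 0) {ε : ℝ} (hε : 0 < ε) {p : ℝ} (hp : 0 < p) :
    ∃ δ : ℝ, 0 < δ ∧ ∀ᶠ k : ℕ in atTop,
      P.real {ω | ε * k ≤ ∑ i ∈ Finset.range k, min (Y i ω) (δ * k)} ≤
        Real.exp 1 * (k : ℝ) ^ (-p) := by
  set a : ℝ := p / ε with ha
  have ha0 : 0 < a := div_pos hp hε
  have hq1 : 0 < (q - 1) / 2 := by linarith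
  refine ⟨(q - 1) / 2 / a, div_pos hq1 ha0, ?_⟩
  set δ : ℝ := (q - 1) / 2 / a with hδ
  have hδ0 : 0 < δ := div_pos hq1 ha0
  set B : ℝ := ∫ ω, |Y 0 ω| ^ q ∂P with hB
  have hlim : Tendsto (fun k : ℕ => a ^ q * B *
      (Real.log k ^ q / (k : ℝ) ^ ((q - 1) / 2))) atTop (𝓝 0) := by
    have h1 := ((isLittleO_log_rpow_rpow_atTop q hq1).tendsto_div_nhds_zero).comp
      (tendsto_natCast_atTop_atTop (R := ℝ))
    simpa using h1.const_mul (a ^ q * B)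
  filter_upwards [eventually_ge_atTop 1, hlim.eventually (ge_mem_nhds one_pos)] with k hk hk1
  have hk0 : (0 : ℝ) < k := by exact_mod_cast (by omega : 0 < k)
  have hlog : 0 ≤ Real.log k := Real.log_natCast_nonneg k
  -- With this `l`, `exp (-l * ε * k) = k ^ (-p)`. The choice of `δ` makes `exp (l * δ * k)` equal
  -- to `k ^ ((q - 1) / 2)`, half of the gain `k ^ (1 - q)`, so the remaining exponent tends to
  -- zero.
  set l : ℝ := a * Real.log k / k with hl
  have hl0 : 0 ≤ l := by positivity
  refine (measureReal_sum_min_ge_le hY hindep hid hq hq2 hint hintq hmean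
    (c := δ * k) (l := l) (by positivity) hl0 k (ε * k)).trans ?_
  have e1 : -l * (ε * k) = Real.log k * (-p) := by
    rw [hl, ha]; field_simp
  have e2 : Real.exp (l * (δ * k)) = (k : ℝ) ^ ((q - 1) / 2) := by
    rw [Real.rpow_def_of_pos hk0, hl, hδ]
    congr 1
    field_simp
  have e3 : l ^ q = a ^ q * Real.log k ^ q * (k : ℝ) ^ (-q) := by
    rw [hl, Real.div_rpow (by positivity) hk0.le, Real.mul_rpow ha0.le hlog,
      Real.rpow_neg hk0.le]
    rfl
  have e4 : (k : ℝ) * ((k : ℝ) ^ (-q) * (k : ℝ) ^ ((q - 1) / 2)) =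
      ((k : ℝ) ^ ((q - 1) / 2))⁻¹ := by
    rw [← Real.rpow_neg hk0.le, ← Real.rpow_add hk0]
    nth_rewrite 1 [← Real.rpow_one (k : ℝ)]
    rw [← Real.rpow_add hk0]
    congr 1
    ring
  have e5 : (k : ℝ) * (l ^ q * Real.exp (l * (δ * k)) * B) ≤ 1 := by
    rw [e2, e3]
    refine le_trans (le_of_eq ?_) hk1
    rw [div_eq_mul_inv (Real.log k ^ q), ← e4]
    ring
  rw [Real.exp_add, e1, ← Real.rpow_def_of_pos hk0, mul_comm]
  exact mul_le_mul_of_nonneg_right (Real.exp_le_exp.2 e5) (by positivity)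

/-- Rate in the one-sided strong law: if the summands have a finite moment of order `s > 1` and
nonpositive mean, the probability that some later average exceeds `ε` is `o(n ^ (1 - s))`. -/
theorem isLittleO_measureReal_exists_lt_sum {Y : ℕ → Ω → ℝ} (hY : ∀ i, Measurable (Y i))
    (hindep : iIndepFun Y P) (hid : ∀ i, IdentDistrib (Y i) (Y 0) P P) {s : ℝ} (hs : 1 < s)
    (hint : Integrable (Y 0) P) (hints : Integrable (fun ω => |Y 0 ω| ^ s) P)
    (hmean : ∫ ω, Y 0 ω ∂P ≤ 0) {ε : ℝ} (hε : 0 < ε) :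
    (fun n : ℕ => P.real {ω | ∃ k ≥ n, ε * k < ∑ i ∈ Finset.range k, Y i ω})
      =o[atTop] (fun n : ℕ => (n : ℝ) ^ (1 - s)) := by
  have hq : 1 < min s 2 := lt_min hs one_lt_two
  have hintq : Integrable (fun ω => |Y 0 ω| ^ min s 2) P := by
    refine ((integrable_const 1).add hints).mono'
      ((hY 0).abs.pow_const _).aestronglyMeasurable (Eventually.of_forall fun ω => ?_)
    rw [Real.norm_of_nonneg (by positivity)]
    have h0 : 0 ≤ |Y 0 ω| ^ s := by positivity
    simp only [Pi.add_apply]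
    rcases le_total |Y 0 ω| 1 with h | h
    · linarith [Real.rpow_le_one (abs_nonneg (Y 0 ω)) h (by linarith : 0 ≤ min s 2)]
    · linarith [Real.rpow_le_rpow_of_exponent_le h (min_le_left s 2)]
  -- The exponent `s + 1` leaves a spare factor `n⁻¹` after summing over `k ≥ n`.
  obtain ⟨δ, hδ, hev⟩ := eventually_measureReal_sum_min_ge_le hY hindep hid hq (min_le_right s 2)
    hint hintq hmean hε (p := s + 1) (by linarith)
  obtain ⟨n₀, hn₀⟩ := eventually_atTop.1 hev
  set C : ℝ := 2 ^ s / (s - 1) with hC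
  have hlim : Tendsto (fun n : ℕ => Real.exp 1 * C * (n : ℝ)⁻¹) atTop (𝓝 0) := by
    simpa using (tendsto_inv_atTop_nhds_zero_nat (𝕜 := ℝ)).const_mul (Real.exp 1 * C)
  have h2 : (fun n : ℕ => Real.exp 1 * C * (n : ℝ)⁻¹ * (n : ℝ) ^ (1 - s))
      =o[atTop] (fun n : ℕ => (n : ℝ) ^ (1 - s)) := by
    simpa using ((isLittleO_one_iff ℝ).2 hlim).mul_isBigO
      (isBigO_refl (fun n : ℕ => (n : ℝ) ^ (1 - s)) atTop)
  refine IsBigO.trans_isLittleO ?_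
    ((isLittleO_measureReal_exists_mul_max_lt hY hid hs hints hδ).add h2)
  refine IsBigO.of_bound 1 ?_
  filter_upwards [eventually_ge_atTop 1, eventually_ge_atTop n₀] with n hn hnn
  rw [one_mul, Real.norm_of_nonneg measureReal_nonneg]
  refine le_trans ?_ (le_abs_self _)
  have hn0 : (0 : ℝ) < n := by exact_mod_cast (by omega : 0 < n)
  have hsub : {ω | ∃ k ≥ n, ε * k < ∑ i ∈ Finset.range k, Y i ω} ⊆
      {ω | ∃ i, δ * (max i n : ℕ) < Y i ω} ∪ ⋃ j : ℕ,
        {ω | ε * (n + j : ℕ) ≤ ∑ i ∈ Finset.range (n + j), min (Y i ω) (δ * (n + j : ℕ))} := by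
    rintro ω ⟨k, hk, hω⟩
    by_cases h : ∃ i, δ * (max i n : ℕ) < Y i ω
    · exact Or.inl h
    · right
      push Not at h
      refine Set.mem_iUnion.2 ⟨k - n, ?_⟩
      simp only [Set.mem_ofPred_eq, Nat.add_sub_cancel' hk]
      refine hω.le.trans (Finset.sum_le_sum fun i hi => le_min le_rfl ((h i).trans ?_))
      have : max i n ≤ k := max_le (Finset.mem_range.1 hi).le hk
      gcongr
  refine (measureReal_mono hsub).trans ((measureReal_union_le _ _).trans (add_le_add_right ?_ _))
  refine measureReal_iUnion_le_of_sum_range_le fun N => ?_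
  calc _ ≤ ∑ j ∈ Finset.range N, Real.exp 1 * (n : ℝ)⁻¹ * ((n + j : ℕ) : ℝ) ^ (-s) := by
        refine Finset.sum_le_sum fun j _ => (hn₀ (n + j) (by omega)).trans ?_
        have hnj : (n : ℝ) ≤ (n + j : ℕ) := by exact_mod_cast Nat.le_add_right n j
        have hnj0 : (0 : ℝ) < (n + j : ℕ) := hn0.trans_le hnj
        rw [mul_assoc, show -(s + 1) = -1 + -s by ring, Real.rpow_add hnj0, Real.rpow_neg_one]
        gcongr
    _ ≤ Real.exp 1 * (n : ℝ)⁻¹ * (C * (n : ℝ) ^ (1 - s)) := by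
        rw [← Finset.mul_sum]
        exact mul_le_mul_of_nonneg_left (sum_range_add_rpow_neg_le hs hn N) (by positivity)
    _ = _ := by ring

/-- The rate in the strong law in the form: partial sums of i.i.d. variables with negative mean are
eventually negative. -/
theorem isLittleO_measureReal_exists_sum_nonneg {Y : ℕ → Ω → ℝ} (hY : ∀ i, Measurable (Y i))
    (hindep : iIndepFun Y P) (hid : ∀ i, IdentDistrib (Y i) (Y 0) P P) {s : ℝ} (hs : 1 < s)
    (hint : Integrable (Y 0) P) (hints : Integrable (fun ω => |Y 0 ω| ^ s) P)
    (hmean : ∫ ω, Y 0 ω ∂P < 0) :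
    (fun n : ℕ => P.real {ω | ∃ k ≥ n, 0 ≤ ∑ i ∈ Finset.range k, Y i ω})
      =o[atTop] (fun n : ℕ => (n : ℝ) ^ (1 - s)) := by
  set μ : ℝ := ∫ ω, Y 0 ω ∂P with hμ
  have hg : Measurable fun y : ℝ => y - μ := measurable_id.sub_const μ
  have hL : MemLp (Y 0) (ENNReal.ofReal s) P := by
    refine (integrable_norm_rpow_iff (hY 0).aestronglyMeasurable (by simp; linarith)
      ENNReal.ofReal_ne_top).1 ?_
    simpa [ENNReal.toReal_ofReal (by linarith : 0 ≤ s)] using hints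
  have hints' : Integrable (fun ω => |Y 0 ω - μ| ^ s) P := by
    have := (hL.sub (memLp_const μ)).integrable_norm_rpow (by simp; linarith) ENNReal.ofReal_ne_top
    simpa [ENNReal.toReal_ofReal (by linarith : 0 ≤ s)] using this
  have key := isLittleO_measureReal_exists_lt_sum (Y := fun i ω => Y i ω - μ)
    (fun i => hg.comp (hY i)) (hindep.comp (fun _ y => y - μ) fun _ => hg)
    (fun i => (hid i).comp hg) hs (hint.sub (integrable_const μ)) hints'
    -- A nonnegative sum has centred value at least `-μ * k`, strictly above `-μ / 2 * k` since `k >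
    -- 0`.
    (by rw [integral_sub hint (integrable_const μ)]; simp [hμ]) (ε := -μ / 2) (by linarith)
  refine IsBigO.trans_isLittleO (IsBigO.of_bound 1 ?_) key
  filter_upwards [eventually_ge_atTop 1] with n hn
  rw [one_mul, Real.norm_of_nonneg measureReal_nonneg, Real.norm_of_nonneg measureReal_nonneg]
  refine measureReal_mono fun ω => ?_
  rintro ⟨k, hk, h⟩
  refine ⟨k, hk, ?_⟩
  have hk0 : (0 : ℝ) < k := by exact_mod_cast (by omega : 0 < k)
  rw [Finset.sum_sub_distrib, Finset.sum_const, Finset.card_range, nsmul_eq_mul]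
  have := mul_neg_of_pos_of_neg hk0 hmean
  linarith

end

/-! ### The estimator -/

theorem mainTheorem7
    {S Ω : Type*} [MeasurableSpace S] [MeasurableSpace Ω]
    (Q : Measure S) [IsProbabilityMeasure Q]
    (P : Measure Ω) [IsProbabilityMeasure P]
    (h : S → ℝ → ℝ)
    (h_meas : ∀ t, Measurable (fun x => h x t))
    (h_conv : ∀ x, ConvexOn ℝ Set.univ (h x))
    (h_right : ∀ t, Integrable (fun x => rightDerivative (h x) t) Q)
    (h_left : ∀ t, Integrable (fun x => leftDerivative (h x) t) Q)
    (t₀ : ℝ)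
    (X : ℕ → Ω → S)
    (X_meas : ∀ i, Measurable (X i))
    (X_indep : iIndepFun X P)
    (X_law : ∀ i, P.map (X i) = Q)
    (mhat : ℕ → Ω → ℝ)
    (h_mhat : IsSmallestMEstimator h X t₀ mhat)
    (m : ℝ)
    (h_unique : minimumSet (criterion h Q t₀) = {m})
    (s : ℝ) (hs : 1 < s)
    (h_moment : ∃ x₀ : ℝ, 0 < x₀ ∧ ∀ x ∈ Set.Icc (-x₀) x₀,
      Integrable (fun ω => |rightDerivative (h (X 0 ω)) (m + x)| ^ s) P)
    (x : ℝ) (hx : 0 < x) :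
    (fun n : ℕ =>
      P.real {ω | (x : EReal) < ⨆ k ≥ n, ((|mhat k ω - m| : ℝ) : EReal)})
      =o[atTop] (fun n : ℕ => (n : ℝ) ^ (1 - s)) := by
  obtain ⟨x₀, hx₀, hmom⟩ := h_moment
  -- Shrinking `x` to `y` puts `m - y` and `m + y` in the range of the moment hypothesis.
  set y : ℝ := min x x₀ with hy
  have hy0 : 0 < y := lt_min hx hx₀
  have hyx : y ≤ x := min_le_left _ _
  have hyx₀ : y ≤ x₀ := min_le_right _ _
  have hD := measurable_rightDerivative h_meas h_conv
  have X_id : ∀ i, IdentDistrib (X i) (X 0) P P := fun i =>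
    ⟨(X_meas i).aemeasurable, (X_meas 0).aemeasurable, by rw [X_law, X_law]⟩
  have hle := integral_rightDerivative_mul_le h_meas h_conv h_right t₀
  have hneg : ∫ z, rightDerivative (h z) (m + -y) ∂Q < 0 := by
    have h1 := hle (m + -y) m
    have h2 := criterion_lt_of_minimumSet_eq_singleton h_unique
      (t := m + -y) (by simpa using hy0.ne')
    by_contra! hcon
    have := mul_nonneg hcon (by linarith : 0 ≤ m - (m + -y))
    linarith
  have hpos : 0 < ∫ z, rightDerivative (h z) (m + y) ∂Q := by
    have h1 := hle (m + y) m
    have h2 := criterion_lt_of_minimumSet_eq_singleton h_unique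
      (t := m + y) (by simpa using hy0.ne')
    by_contra! hcon
    have := mul_nonneg_of_nonpos_of_nonpos hcon (by linarith : m - (m + y) ≤ 0)
    linarith
  have hmap : ∀ t, ∫ ω, rightDerivative (h (X 0 ω)) t ∂P = ∫ z, rightDerivative (h z) t ∂Q := by
    intro t
    rw [← X_law 0, integral_map (X_meas 0).aemeasurable (hD t).aestronglyMeasurable]
  have hcomp : ∀ t, Integrable (fun ω => rightDerivative (h (X 0 ω)) t) P := by
    intro t
    have := h_right t
    rw [← X_law 0] at this
    exact this.comp_measurable (X_meas 0)
  have hA := isLittleO_measureReal_exists_sum_nonneg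
    (Y := fun i ω => rightDerivative (h (X i ω)) (m + -y))
    (fun i => (hD _).comp (X_meas i)) (X_indep.comp (fun _ z => rightDerivative (h z) (m + -y))
      fun _ => hD _) (fun i => (X_id i).comp (hD _)) hs (hcomp _)
    (hmom (-y) ⟨by linarith, by linarith⟩) (by rw [hmap]; exact hneg)
  have hB := isLittleO_measureReal_exists_sum_nonneg
    (Y := fun i ω => -rightDerivative (h (X i ω)) (m + y))
    (fun i => ((hD _).comp (X_meas i)).neg)
    (X_indep.comp (fun _ z => -rightDerivative (h z) (m + y)) fun _ => (hD _).neg)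
    (fun i => (X_id i).comp (hD _).neg) hs (hcomp _).neg
    (by simpa only [abs_neg] using hmom y ⟨by linarith, by linarith⟩)
    (by rw [integral_neg, hmap]; linarith)
  refine IsBigO.trans_isLittleO (IsBigO.of_bound 1 ?_) (hA.add hB)
  filter_upwards [eventually_ge_atTop 1] with n hn
  rw [one_mul, Real.norm_of_nonneg measureReal_nonneg]
  refine le_trans ?_ (le_abs_self _)
  -- Monotonicity needs no measurability, so arbitrary values of `mhat` are harmless.
  refine (measureReal_mono fun ω hω => ?_).trans (measureReal_union_le _ _)
  simp only [Set.mem_ofPred_eq, lt_iSup_iff, EReal.coe_lt_coe_iff] at hω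
  obtain ⟨k, hk, hxk⟩ := hω
  by_contra hcon
  simp only [Set.mem_union, Set.mem_ofPred_eq, not_or, not_exists, not_and, not_le,
    Finset.sum_neg_distrib, neg_lt_zero] at hcon
  obtain ⟨t, ht, hleast⟩ := exists_isLeast_minimumSet_empiricalCriterion h_conv X t₀ (hn.trans hk) ω
    (by linarith : m + -y < m + y) (hcon.1 k hk) (hcon.2 k hk)
  rw [h_mhat k (hn.trans hk) ω t hleast] at hxk
  have : |t - m| ≤ y := abs_le.2 ⟨by linarith [ht.1], by linarith [ht.2]⟩
  linarith
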